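/- Generic quantum Wielandt's inequality. For a finite set $S\subseteq M_n(\mathbb{C})$, the Wie-length $\mathrm{Wie}\ell(S)$ is the least $k\in\mathbb{N}=\{0,1,2,\dots\}$ such that the products $A_1A_2\cdots A_k$ of exactly $k$ elements of $S$ span $M_n(\mathbb{C})$ (the empty product is the identity), with $\mathrm{Wie}\ell(S)=\infty$ if there is no such $k$; $S$ is a Wie-generating system if $\mathrm{Wie}\ell(S)<\infty$. The Wie-length of a tuple is that of its set of entries. Let $g\ge 2$. (1) For every $n\ge 1$, the set of $g$-tuples $S=(A_1,\dots,A_g)\in M_n(\mathbb{C})^g$ with $\mathrm{Wie}\ell(S)>2\lceil\log_g n\rceil$ has Lebesgue measure zero in $M_n(\mathbb{C})^g$. In other words, for Lebesgue-almost every $S\in M_n(\mathbb{C})^g$ the products of exactly $2\lceil\log_g n\rceil$ entries of $S$ span $M_n(\mathbb{C})$. (2) For every $n\ge 1$ and every Wie-generating $g$-tuple $S\in M_n(\mathbb{C})^g$ one has $g^{\mathrm{Wie}\ell(S)}\ge n^2$. (3) Consequently the generic Wie-length is $\Theta(\log n)$: there are constants $c,C>0$ depending only on $g$ such that for every $n\ge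 1$, Lebesgue-almost every $S\in M_n(\mathbb{C})^g$ is a Wie-generating system and satisfies $c\log n\le \mathrm{Wie}\ell(S)\le C\log n$. -/

import Mathlib

open MeasureTheory

/-- The set of all products `A₁ A₂ ⋯ A_k` of exactly `k` matrices taken from `S`
(repetitions allowed; for `k = 0` this is the empty product, the identity matrix). -/
def wordsOfLength {n : ℕ} (S : Set (Matrix (Fin n) (Fin n) ℂ)) (k : ℕ) :
    Set (Matrix (Fin n) (Fin n) ℂ) :=
  {M | ∃ w : List (Matrix (Fin n) (Fin n) ℂ), w.length = k ∧ (∀ A ∈ w, A ∈ S) ∧ w.prod = M}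

/-- The products of exactly `k` elements of `S` span the whole matrix algebra over `ℂ`. -/
def SpansAtLength {n : ℕ} (S : Set (Matrix (Fin n) (Fin n) ℂ)) (k : ℕ) : Prop :=
  Submodule.span ℂ (wordsOfLength S k) = ⊤

/-- The Wie-length of `S`: the least `k` such that the products of exactly `k` elements of `S`
span the matrix algebra. It is `⊤` if there is no such `k`, that is, if `S` is not a
Wie-generating system. -/
noncomputable def wieLength {n : ℕ} (S : Set (Matrix (Fin n) (Fin n) ℂ)) : ℕ∞ :=
  ⨅ (k : ℕ) (_ : SpansAtLength S k), (k : ℕ∞)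

/-- Lebesgue measure on the space of complex `n × n` matrices: the product, over the entries,
of Lebesgue measure on `ℂ`. On `g`-tuples of matrices this induces the product measure. -/
noncomputable instance matrixMeasureSpace (n : ℕ) : MeasureSpace (Matrix (Fin n) (Fin n) ℂ) :=
  inferInstanceAs (MeasureSpace (Fin n → Fin n → ℂ))

/-!
The idea is to exhibit, for each `n`, one tuple whose words of length `2 ℓ`, `ℓ = ⌈log_g n⌉`, span.
That `n²` given words are linearly independent is the nonvanishing of a determinant that is
polynomial in the entries of the tuple, and the zero set of a holomorphic function that does not
vanish identically is null (`NullZeroSets`, by Fubini from one variable), so the words then span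
for almost every tuple (`ae_spansAtLength_of_det_ne_zero`).

The tuple comes from an automaton with `n` states and `g` letters in which every word of length `ℓ`
is a reset word, and in which one can choose a letter `policy s` for each state `s` such that
`D s = step s (policy s)` permutes the states. Let `A i` be the transition matrix of the letter `i`,
with weight `1` on the transitions chosen by the policy and weight `ε` elsewhere. A word `u` of
length `ℓ` then has a rank one value `f_u * e_τᵀ`, where `τ` is the state to which `u` resets.
For the word `u s` read by following the policy from `s` one has `τ = D^ℓ s`, so `s` is determined
by `u s`, whence `f_{u s}` is `e_s` at `ε = 0`, and the `f_{u s}` form a basis for small `ε`.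
The value of `u s ++ u t` is a multiple of `f_{u s} * e_{D^ℓ t}ᵀ`, with a factor that is
nonzero for `ε ≠ 0`, and these `n²` matrices form a basis (`exists_det_words_ne_zero`).

Such automata exist for all `g ^ (ℓ - 1) ≤ n ≤ g ^ ℓ`, by recursion on `ℓ` along `n = g q + r`
(`ResetAutomaton.exists_card_eq`). From an automaton with `q` states one gets one with `g q` states
and reset length larger by one, by remembering the last letter and feeding the differences of
consecutive letters, taken modulo `g`, to the old automaton. The remaining `r < g` states are loops:
the letter `a ≠ 0`, read in suitable circumstances after another `a`, leads to a new state on which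
the policy stays forever by reading `a`.

The lower bound is a dimension count: `g ^ k` words have to span a space of dimension `n ^ 2`.
-/


/-! ### Automata that are reset by every long enough word -/

/-- A deterministic automaton with states `T` and alphabet `G` such that every word of length `ℓ`
is a reset word (its final state does not depend on the initial one), together with a choice
`policy` of one letter per state along which the automaton permutes its states.
The set `K` and the state `z` are what the recursive construction needs in order to attach further
states: membership in `K` is already decided by `ℓ - 1` letters, the policy never reads `0`
on `K`, and the letter `0` sends all of `K` to `z`. -/
structure ResetAutomaton (G T : Type) [AddCommGroup G] (ℓ : ℕ) where
  step : T → G → T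
  policy : T → G
  reset : ∀ w : List G, w.length = ℓ → ∀ s t, w.foldl step s = w.foldl step t
  injective_step_policy : Function.Injective fun s => step s (policy s)
  K : Set T
  z : T
  reset_K : ∀ w : List G, w.length + 1 = ℓ → ∀ s t, (w.foldl step s ∈ K ↔ w.foldl step t ∈ K)
  policy_ne_zero : ∀ s ∈ K, policy s ≠ 0
  step_zero : ∀ s ∈ K, step s 0 = z

/-- Consecutive differences of the list `a :: w`. -/
def consecutiveDiffs {G : Type} [AddCommGroup G] : G → List G → List G
  | _, [] => []
  | a, b :: w => (b - a) :: consecutiveDiffs b w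

theorem length_consecutiveDiffs {G : Type} [AddCommGroup G] (a : G) (w : List G) :
    (consecutiveDiffs a w).length = w.length := by
  induction w generalizing a with
  | nil => rfl
  | cons b w ih => simp [consecutiveDiffs, ih]

namespace ResetAutomaton

variable {G T : Type} [AddCommGroup G] {ℓ : ℕ}

/-- The automaton on `T × G` that remembers the last letter and feeds the difference of
consecutive letters to `R`. -/
def diffStep (R : ResetAutomaton G T ℓ) (p : T × G) (i : G) : T × G :=
  (R.step p.1 (i - p.2), i)

theorem foldl_diffStep (R : ResetAutomaton G T ℓ) (w : List G) (s : T) (a : G) :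
    w.foldl R.diffStep (s, a) =
      ((consecutiveDiffs a w).foldl R.step s, w.getLastD a) := by
  induction w generalizing s a with
  | nil => rfl
  | cons b w ih => simp only [List.foldl_cons, diffStep, ih, consecutiveDiffs,
      List.getLastD_cons]

/-- After its first letter, a run of the difference automaton depends only on the state that
letter leads to, and hence, for words of length `ℓ + 1`, on nothing but the word. -/
theorem foldl_diffStep_eq (R : ResetAutomaton G T ℓ) (w : List G) (hw : w.length = ℓ + 1)
    (p q : T × G) : w.foldl R.diffStep p = w.foldl R.diffStep q := by
  obtain _ | ⟨i, w⟩ := w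
  · simp at hw
  · simp only [List.foldl_cons, diffStep, foldl_diffStep]
    rw [R.reset _ _ _ (R.step q.1 (i - q.2))]
    simpa [length_consecutiveDiffs] using hw

theorem foldl_diffStep_snd_eq (R : ResetAutomaton G T ℓ) (w : List G) (hw : w ≠ [])
    (p q : T × G) : (w.foldl R.diffStep p).2 = (w.foldl R.diffStep q).2 := by
  obtain _ | ⟨i, w⟩ := w
  · simp at hw
  · simp only [List.foldl_cons, diffStep, foldl_diffStep]

theorem foldl_diffStep_fst_mem_iff (R : ResetAutomaton G T ℓ) (w : List G) (hw : w.length = ℓ)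
    (hℓ : 1 ≤ ℓ) (p q : T × G) :
    (w.foldl R.diffStep p).1 ∈ R.K ↔ (w.foldl R.diffStep q).1 ∈ R.K := by
  obtain _ | ⟨i, w⟩ := w
  · simp at hw; omega
  · simp only [List.foldl_cons, diffStep, foldl_diffStep]
    exact R.reset_K _ (by simpa [length_consecutiveDiffs] using hw) _ _

/-- The state of the difference automaton underlying a state of `extend`: the additional state
`e` behaves like `(z, e)`. -/
def proj (R : ResetAutomaton G T ℓ) (E : Finset G) : (T × G) ⊕ E → T × G
  | .inl p => p
  | .inr e => (R.z, e)

open Classical in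
/-- The transition of `extend`: as in the difference automaton, except that a letter `i ∈ E` read
right after the same letter, with the underlying state of `R` in `K`, leads to the additional state `i`. -/
noncomputable def extendStep (R : ResetAutomaton G T ℓ) (E : Finset G) (x : (T × G) ⊕ E) (i : G) :
    (T × G) ⊕ E :=
  if h : ((R.proj E x).1 ∈ R.K ∧ (R.proj E x).2 = i) ∧ i ∈ E then .inr ⟨i, h.2⟩
  else .inl (R.diffStep (R.proj E x) i)

theorem proj_extendStep (R : ResetAutomaton G T ℓ) (E : Finset G) (x : (T × G) ⊕ E) (i : G) :
    R.proj E (R.extendStep E x i) = R.diffStep (R.proj E x) i := by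
  unfold extendStep
  split_ifs with h
  · refine Prod.ext ?_ rfl
    change R.z = R.step (R.proj E x).1 (i - (R.proj E x).2)
    rw [h.1.2, sub_self, R.step_zero _ h.1.1]
  · rfl

theorem extendStep_congr (R : ResetAutomaton G T ℓ) (E : Finset G) {x y : (T × G) ⊕ E} {i : G}
    (h1 : (R.proj E x).1 ∈ R.K ↔ (R.proj E y).1 ∈ R.K) (h2 : (R.proj E x).2 = (R.proj E y).2)
    (h : R.diffStep (R.proj E x) i = R.diffStep (R.proj E y) i) :
    R.extendStep E x i = R.extendStep E y i := by
  have hiff : ((R.proj E x).1 ∈ R.K ∧ (R.proj E x).2 = i) ∧ i ∈ E ↔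
      ((R.proj E y).1 ∈ R.K ∧ (R.proj E y).2 = i) ∧ i ∈ E := by rw [h1, h2]
  unfold extendStep
  split_ifs with hx hy hy
  · rfl
  · exact absurd (hiff.1 hx) hy
  · exact absurd (hiff.2 hy) hx
  · rw [h]

theorem proj_foldl (R : ResetAutomaton G T ℓ) (E : Finset G) (w : List G) (x : (T × G) ⊕ E) :
    R.proj E (w.foldl (R.extendStep E) x) = w.foldl R.diffStep (R.proj E x) := by
  induction w generalizing x with
  | nil => rfl
  | cons i w ih => simp only [List.foldl_cons, ih, proj_extendStep]

theorem extendStep_reset (R : ResetAutomaton G T ℓ) (hℓ : 1 ≤ ℓ) (E : Finset G) (w : List G)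
    (hw : w.length = ℓ + 1) (x y : (T × G) ⊕ E) :
    w.foldl (R.extendStep E) x = w.foldl (R.extendStep E) y := by
  have hp := R.foldl_diffStep_eq w hw (R.proj E x) (R.proj E y)
  obtain rfl | ⟨v, i, rfl⟩ := List.eq_nil_or_concat' w
  · simp at hw
  have hv : v.length = ℓ := by simpa using hw
  have h2 := R.foldl_diffStep_snd_eq v (by rintro rfl; simp at hv; omega)
    (R.proj E x) (R.proj E y)
  have h1 := R.foldl_diffStep_fst_mem_iff v hv hℓ (R.proj E x) (R.proj E y)
  simp only [List.foldl_append, List.foldl_cons, List.foldl_nil] at hp ⊢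
  rw [← proj_foldl, ← proj_foldl] at h1 h2
  rw [← proj_foldl, ← proj_foldl] at hp
  exact R.extendStep_congr E h1 h2 hp

/-- From `|T|` states to `|G| |T| + |E|` states, at the cost of one more letter. -/
noncomputable def extend (R : ResetAutomaton G T ℓ) (hℓ : 1 ≤ ℓ) (E : Finset G) (h0 : (0 : G) ∉ E)
    (hE : E.Nonempty → R.z ∈ R.K) : ResetAutomaton G ((T × G) ⊕ E) (ℓ + 1) where
  step := R.extendStep E
  policy
    | .inl p => p.2 + R.policy p.1
    | .inr e => e
  reset w hw := R.extendStep_reset hℓ E w hw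
  injective_step_policy := by
    have hl (p : T × G) : R.extendStep E (.inl p) (p.2 + R.policy p.1) =
        .inl (R.step p.1 (R.policy p.1), p.2 + R.policy p.1) := by
      unfold extendStep
      rw [dif_neg]
      · simp [proj, diffStep]
      · rintro ⟨⟨h1, h2⟩, -⟩
        exact R.policy_ne_zero _ h1 (by simpa [proj] using h2)
    have hr (e : E) : R.extendStep E (.inr e) e = .inr e := by
      unfold extendStep
      rw [dif_pos ⟨⟨hE ⟨e, e.2⟩, rfl⟩, e.2⟩]
    rintro (⟨s, a⟩ | e) (⟨t, b⟩ | f) h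
    · simp only [hl, Sum.inl.injEq, Prod.mk.injEq] at h
      obtain rfl := R.injective_step_policy h.1
      simpa using h.2
    · simp [hl, hr] at h
    · simp [hl, hr] at h
    · simpa [hr] using h
  K := {x | (R.proj E x).1 ∈ R.K ∧ (R.proj E x).2 = 0}
  z := .inl (R.z, 0)
  reset_K w hw x y := by
    have hw : w.length = ℓ := by simpa using hw
    simp only [Set.mem_ofPred_eq, proj_foldl]
    rw [R.foldl_diffStep_fst_mem_iff w hw hℓ (R.proj E x) (R.proj E y),
      R.foldl_diffStep_snd_eq w (by rintro rfl; simp at hw; omega) (R.proj E x) (R.proj E y)]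
  policy_ne_zero := by
    rintro (⟨s, a⟩ | e) ⟨h1, h2⟩
    · obtain rfl : a = 0 := h2
      simpa using R.policy_ne_zero s h1
    · exact absurd e.2 ((show (e : G) = 0 from h2) ▸ h0)
  step_zero x hx := by
    unfold extendStep
    rw [dif_neg (fun h => h0 h.2)]
    simp [diffStep, hx.2, R.step_zero _ hx.1]

theorem exists_of_length_one {g n : ℕ} [NeZero g] (hn : 1 ≤ n) (hng : n ≤ g) :
    ∃ R : ResetAutomaton (Fin g) (Fin n) 1, n < g → R.z ∈ R.K := by
  have : NeZero n := ⟨by omega⟩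
  -- counting down from `g - 1` keeps the policy away from the letter `0` as long as `n < g`
  let σ : Fin n → Fin g := fun s => ⟨g - 1 - s, by omega⟩
  have hσ : Function.Injective σ := fun s t h => by
    have := congrArg Fin.val h
    simp only [σ] at this
    omega
  refine ⟨{ step := fun _ i => Function.invFun σ i
            policy := σ
            reset := ?_
            injective_step_policy := ?_
            K := {_s | n < g}
            z := Function.invFun σ 0
            reset_K := fun _ _ _ _ => Iff.rfl
            policy_ne_zero := ?_
            step_zero := fun _ _ => rfl }, fun h => h⟩
  · intro w hw s t
    obtain ⟨i, rfl⟩ := List.length_eq_one_iff.1 hw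
    rfl
  · intro s t h
    simpa [Function.leftInverse_invFun hσ _] using h
  · intro s (hs : n < g) h
    have := congrArg Fin.val h
    simp only [σ, Fin.val_zero] at this
    omega

/-- Writing `n = g q + r`, the numbers of states between `g ^ ℓ` and `g ^ (ℓ + 1)` are all reached
by extending an automaton with `q` states by `r` additional ones. -/
theorem exists_card_eq {g : ℕ} [NeZero g] (ℓ n : ℕ) (h1 : g ^ ℓ ≤ n) (h2 : n ≤ g ^ (ℓ + 1)) :
    ∃ (T : Type) (_ : Fintype T) (R : ResetAutomaton (Fin g) T (ℓ + 1)),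
      Fintype.card T = n ∧ (n < g ^ (ℓ + 1) → R.z ∈ R.K) := by
  have hg : 0 < g := NeZero.pos g
  induction ℓ generalizing n with
  | zero =>
    obtain ⟨R, hR⟩ := exists_of_length_one (g := g) (n := n) (by simpa using h1) (by simpa using h2)
    exact ⟨Fin n, inferInstance, R, by simp, by simpa using hR⟩
  | succ ℓ ih =>
    have hdiv := Nat.div_add_mod n g
    have hmod := Nat.mod_lt n hg
    obtain ⟨T, _, R, hT, hR⟩ := ih (n / g)
      ((Nat.le_div_iff_mul_le hg).2 (by rwa [← pow_succ]))
      (Nat.div_le_of_le_mul (by rwa [← pow_succ']))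
    have hq : n < g ^ (ℓ + 1 + 1) → R.z ∈ R.K := fun h =>
      hR (Nat.div_lt_of_lt_mul (by rwa [← pow_succ']))
    obtain ⟨E, hE, hEc⟩ := Finset.exists_subset_card_eq
      (s := (Finset.univ : Finset (Fin g)).erase 0) (n := n % g) (by
        rw [Finset.card_erase_of_mem (Finset.mem_univ _), Finset.card_fin]; omega)
    refine ⟨_, inferInstance, R.extend (by omega) E (fun h => by simpa using hE h) ?_, ?_, ?_⟩
    · intro hne
      have hr : 0 < n % g := hEc ▸ hne.card_pos
      refine hq (lt_of_le_of_ne h2 fun h => ?_)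
      rw [h, pow_succ, Nat.mul_mod_left] at hr
      exact lt_irrefl _ hr
    · rw [Fintype.card_sum, Fintype.card_prod, Fintype.card_fin, Fintype.card_coe, hT, hEc,
        mul_comm, hdiv]
    · exact fun h => ⟨hq h, rfl⟩

end ResetAutomaton

/-- For `ℓ = 0` the truncated `ℓ - 1` forces `n = 1`, where the single state is trivially reset. -/
theorem exists_reset_step {g : ℕ} [NeZero g] (ℓ n : ℕ) (h1 : g ^ (ℓ - 1) ≤ n) (h2 : n ≤ g ^ ℓ) :
    ∃ (step : Fin n → Fin g → Fin n) (policy : Fin n → Fin g),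
      (∀ w : List (Fin g), w.length = ℓ → ∀ s t, w.foldl step s = w.foldl step t) ∧
      Function.Injective fun s => step s (policy s) := by
  obtain _ | ℓ := ℓ
  · have : Subsingleton (Fin n) := Fin.subsingleton_iff_le_one.2 (by simpa using h2)
    exact ⟨fun s _ => s, fun _ => 0, fun _ _ _ _ => Subsingleton.elim _ _, fun _ _ h => h⟩
  · obtain ⟨T, _, R, hT, -⟩ := ResetAutomaton.exists_card_eq (g := g) ℓ n h1 h2
    let e := Fintype.equivFinOfCardEq hT
    have key (w : List (Fin g)) (s : Fin n) :
        w.foldl (fun s i => e (R.step (e.symm s) i)) s = e (w.foldl R.step (e.symm s)) := by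
      induction w generalizing s with
      | nil => simp
      | cons i w ih => simp [ih]
    refine ⟨fun s i => e (R.step (e.symm s) i), fun s => R.policy (e.symm s), ?_, ?_⟩
    · intro w hw s t
      rw [key, key, R.reset w hw]
    · intro s t h
      exact e.symm.injective (R.injective_step_policy (e.injective h))

/-! ### Words in weighted transition matrices -/

section Weighted

variable {T G : Type*}

/-- The product of the weights `x` along the run of the word `w` from the state `s`. -/
def runWeight (step : T → G → T) (x : T → G → ℂ) : T → List G → ℂ
  | _, [] => 1
  | s, i :: w => x s i * runWeight step x (step s i) w

theorem runWeight_append (step : T → G → T) (x : T → G → ℂ) (s : T) (u v : List G) :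
    runWeight step x s (u ++ v) = runWeight step x s u * runWeight step x (u.foldl step s) v := by
  induction u generalizing s with
  | nil => simp [runWeight]
  | cons i u ih => simp [runWeight, ih, mul_assoc]

theorem prod_transition_apply [Fintype T] [DecidableEq T] (step : T → G → T) (x : T → G → ℂ)
    (w : List G) (s t : T) :
    (w.map fun i => Matrix.of fun s t => if step s i = t then x s i else 0).prod s t =
      if w.foldl step s = t then runWeight step x s w else 0 := by
  induction w generalizing s with
  | nil =>
    simp only [List.map_nil, List.prod_nil, Matrix.one_apply, runWeight, List.foldl_nil]
    rfl
  | cons i w ih =>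
    simp only [List.map_cons, List.prod_cons, Matrix.mul_apply, Matrix.of_apply, ih]
    rw [Finset.sum_eq_single (step s i) (fun j _ hj => by rw [if_neg (Ne.symm hj), zero_mul])
      (fun h => absurd (Finset.mem_univ _) h)]
    simp only [if_true, List.foldl_cons, runWeight, mul_ite, mul_zero]
    rfl

/-- The word of length `k` read by following `policy` from a given state. -/
def policyWord (step : T → G → T) (policy : T → G) : ℕ → T → List G
  | 0, _ => []
  | k + 1, s => policy s :: policyWord step policy k (step s (policy s))

theorem length_policyWord (step : T → G → T) (policy : T → G) (k : ℕ) (s : T) :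
    (policyWord step policy k s).length = k := by
  induction k generalizing s with
  | zero => rfl
  | succ k ih => simp [policyWord, ih]

theorem foldl_policyWord (step : T → G → T) (policy : T → G) (k : ℕ) (s : T) :
    (policyWord step policy k s).foldl step s = (fun s => step s (policy s))^[k] s := by
  induction k generalizing s with
  | zero => rfl
  | succ k ih => simp [policyWord, ih]

variable [DecidableEq G]

/-- Weight `1` for letters that follow the policy and `ε` for deviations. -/
def policyWeight (policy : T → G) (ε : ℂ) (s : T) (i : G) : ℂ :=
  if i = policy s then 1 else ε

theorem continuous_runWeight (step : T → G → T) (policy : T → G) (s : T) (w : List G) :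
    Continuous fun ε => runWeight step (policyWeight policy ε) s w := by
  induction w generalizing s with
  | nil => exact continuous_const
  | cons i w ih =>
    refine Continuous.mul ?_ (ih _)
    unfold policyWeight
    split_ifs <;> fun_prop

theorem runWeight_ne_zero (step : T → G → T) (policy : T → G) {ε : ℂ} (hε : ε ≠ 0) (s : T)
    (w : List G) : runWeight step (policyWeight policy ε) s w ≠ 0 := by
  induction w generalizing s with
  | nil => exact one_ne_zero
  | cons i w ih =>
    refine mul_ne_zero ?_ (ih _)
    unfold policyWeight
    split_ifs
    exacts [one_ne_zero, hε]

theorem runWeight_zero (step : T → G → T) (policy : T → G) (s : T) (w : List G) :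
    runWeight step (policyWeight policy 0) s w =
      if w = policyWord step policy w.length s then 1 else 0 := by
  induction w generalizing s with
  | nil => rfl
  | cons i w ih =>
    by_cases h : i = policy s
    · subst h; simp [runWeight, policyWeight, policyWord, ih]
    · simp [runWeight, policyWeight, policyWord, h]

/-- For a reset automaton, the words `u s ++ u t` with `u = policyWord` have linearly independent
values on suitably weighted transition matrices: that value is a nonzero multiple of
`f s * (e (D^ℓ t))ᵀ`, where `e` is the standard basis, `D` is the permutation of the states given
by the policy, and the vectors `f s` are close to the `e s`. -/
theorem exists_det_words_ne_zero [Fintype T] [DecidableEq T] (step : T → G → T) (policy : T → G)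
    (ℓ : ℕ) (hreset : ∀ w : List G, w.length = ℓ → ∀ s t, w.foldl step s = w.foldl step t)
    (hinj : Function.Injective fun s => step s (policy s)) :
    ∃ (A : G → Matrix T T ℂ) (u : T × T → List G), (∀ p, (u p).length = 2 * ℓ) ∧
      (Matrix.of fun p q : T × T => ((u p).map A).prod q.1 q.2).det ≠ 0 := by
  set D : T → T := (fun s => step s (policy s))^[ℓ] with hD
  have hDinj : Function.Injective D := hinj.iterate ℓ
  set u := policyWord step policy ℓ with hu
  have hul (s : T) : (u s).length = ℓ := length_policyWord ..
  have hrun (s t : T) : (u t).foldl step s = D t := by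
    rw [hreset _ (hul t) s t, hu, foldl_policyWord]
  have huinj : Function.Injective u := fun s t h => hDinj (by rw [← hrun s s, ← hrun s t, h])
  let W : ℂ → Matrix T T ℂ := fun ε => .of fun s t => runWeight step (policyWeight policy ε) t (u s)
  have hW0 : W 0 = 1 := by
    ext s t
    simp only [W, Matrix.of_apply, runWeight_zero, hul, Matrix.one_apply]
    exact if_congr huinj.eq_iff rfl rfl
  have hWc : Continuous fun ε => (W ε).det :=
    Continuous.matrix_det (continuous_matrix fun s t => continuous_runWeight step policy t (u s))
  obtain ⟨ε, hε, hdet⟩ : ∃ ε : ℂ, ε ≠ 0 ∧ (W ε).det ≠ 0 := by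
    have h1 : ∀ᶠ ε in nhds (0 : ℂ), (W ε).det ≠ 0 :=
      hWc.continuousAt.eventually_ne (by simp [hW0])
    obtain ⟨ε, h, h'⟩ := ((h1.filter_mono nhdsWithin_le_nhds).and
      (self_mem_nhdsWithin (a := (0 : ℂ)) (s := {0}ᶜ))).exists
    exact ⟨ε, h', h⟩
  let P : Equiv.Perm T := Equiv.ofBijective D (Finite.injective_iff_bijective.1 hDinj)
  refine ⟨fun i => .of fun s t => if step s i = t then policyWeight policy ε s i else 0,
    fun p => u p.1 ++ u p.2, fun p => by simp [hul, two_mul], ?_⟩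
  have hfactor : (Matrix.of fun p q : T × T => (((u p.1 ++ u p.2).map
      fun i => Matrix.of fun s t => if step s i = t then policyWeight policy ε s i else 0).prod
        q.1 q.2)) =
      Matrix.diagonal (fun p : T × T => runWeight step (policyWeight policy ε) (D p.1) (u p.2)) *
        Matrix.kroneckerMap (· * ·) (W ε) (P.permMatrix ℂ) := by
    ext ⟨s, t⟩ ⟨s', t'⟩
    simp only [Matrix.of_apply, prod_transition_apply, Matrix.diagonal_mul, Matrix.kroneckerMap_apply,
      runWeight_append, List.foldl_append, hrun, W, P, Equiv.Perm.permMatrix,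
      PEquiv.toMatrix_apply, Equiv.toPEquiv_apply, Option.mem_some_iff, Equiv.ofBijective_apply]
    split_ifs <;> ring
  rw [hfactor, Matrix.det_mul, Matrix.det_diagonal, Matrix.det_kronecker, Matrix.det_permutation]
  refine mul_ne_zero (Finset.prod_ne_zero_iff.2 fun p _ => runWeight_ne_zero _ _ hε _ _)
    (mul_ne_zero (pow_ne_zero _ hdet) (pow_ne_zero _ ?_))
  obtain h | h := Int.units_eq_one_or (Equiv.Perm.sign P) <;> simp [h]

end Weighted

/-! ### Zero sets of holomorphic functions are null -/

theorem ae_ne_zero_of_differentiable {F : ℂ → ℂ} (hF : Differentiable ℂ F) {z : ℂ}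
    (hz : F z ≠ 0) : ∀ᵐ x : ℂ, F x ≠ 0 := by
  have han : AnalyticOnNhd ℂ F Set.univ := fun x _ => hF.analyticAt x
  have h := han.preimage_zero_mem_codiscrete hz
  rw [← Measure.restrict_univ (μ := (volume : Measure ℂ))]
  exact ae_restrict_le_codiscreteWithin MeasurableSet.univ h

/-- The measure does not charge the zero set of any holomorphic function that does not vanish
identically. -/
def NullZeroSets {X : Type*} [NormedAddCommGroup X] [NormedSpace ℂ X] [MeasurableSpace X]
    (μ : Measure X) : Prop :=
  ∀ F : X → ℂ, Differentiable ℂ F → ∀ x, F x ≠ 0 → ∀ᵐ y ∂μ, F y ≠ 0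

theorem NullZeroSets.prod {X Y : Type*} [NormedAddCommGroup X] [NormedSpace ℂ X]
    [MeasurableSpace X] [NormedAddCommGroup Y] [NormedSpace ℂ Y] [MeasurableSpace Y]
    [BorelSpace X] [BorelSpace Y] [SecondCountableTopology X] [SecondCountableTopology Y]
    {μ : Measure X} {ν : Measure Y} [SFinite μ] [SFinite ν]
    (hμ : NullZeroSets μ) (hν : NullZeroSets ν) : NullZeroSets (μ.prod ν) := by
  rintro F hF ⟨x, y⟩ hxy
  have hm : MeasurableSet {p | F p ≠ 0} :=
    hF.continuous.measurable (measurableSet_singleton 0).compl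
  rw [Measure.ae_prod_iff_ae_ae hm]
  filter_upwards [hμ (fun x => F (x, y)) (by fun_prop) x hxy] with a ha
  exact hν (fun y => F (a, y)) (by fun_prop) y ha

theorem NullZeroSets.pi {X : Type*} [NormedAddCommGroup X] [NormedSpace ℂ X]
    [MeasureSpace X] [BorelSpace X] [SecondCountableTopology X]
    [SigmaFinite (volume : Measure X)]
    (h : NullZeroSets (volume : Measure X)) (m : ℕ) :
    NullZeroSets (volume : Measure (Fin m → X)) := by
  induction m with
  | zero =>
    intro F _ x hx
    exact Filter.Eventually.of_forall fun y => Subsingleton.elim x y ▸ hx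
  | succ m ih =>
    intro F hF x hx
    have hmp := (volume_preserving_piFinSuccAbove (fun _ : Fin (m + 1) => X) 0)
    have hd : Differentiable ℂ fun p : X × (Fin m → X) => F (Fin.cons p.1 p.2) := by
      refine hF.comp (differentiable_pi.2 fun i => ?_)
      refine Fin.cases ?_ (fun j => ?_) i
      · simp only [Fin.cons_zero]; fun_prop
      · simp only [Fin.cons_succ]; fun_prop
    have := hmp.quasiMeasurePreserving.ae ((h.prod ih) _ hd (x 0, Fin.tail x)
      (by simpa using hx))
    filter_upwards [this] with y hy
    simpa [MeasurableEquiv.piFinSuccAbove, Fin.insertNthEquiv] using hy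

/-! ### Spanning words and the Wie-length -/

variable {n : ℕ}

/-- A finite Wie-length is attained. -/
theorem spansAtLength_of_wieLength_eq {S : Set (Matrix (Fin n) (Fin n) ℂ)} {k : ℕ}
    (h : wieLength S = k) : SpansAtLength S k := by
  have hne : {m : ℕ | SpansAtLength S m}.Nonempty := by
    by_contra hne
    have h0 : ∀ m, ¬ SpansAtLength S m := fun m hm => hne ⟨m, hm⟩
    simp [wieLength, h0] at h
  have hle : wieLength S = (sInf {m : ℕ | SpansAtLength S m} : ℕ) :=
    le_antisymm (iInf₂_le _ (Nat.sInf_mem hne))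
      (le_iInf₂ fun m hm => Nat.cast_le.2 (Nat.sInf_le hm))
  rw [hle, Nat.cast_inj] at h
  exact h ▸ Nat.sInf_mem hne

theorem wieLength_le {S : Set (Matrix (Fin n) (Fin n) ℂ)} {k : ℕ} (h : SpansAtLength S k) :
    wieLength S ≤ k :=
  iInf₂_le k h

theorem wordsOfLength_range {g : ℕ} (A : Fin g → Matrix (Fin n) (Fin n) ℂ) (k : ℕ) :
    wordsOfLength (Set.range A) k = Set.range fun f : Fin k → Fin g =>
      (List.ofFn fun j => A (f j)).prod := by
  ext M
  constructor
  · rintro ⟨w, rfl, hw, rfl⟩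
    choose f hf using fun j : Fin w.length => hw _ (w.get_mem j)
    exact ⟨f, by simp [hf]⟩
  · rintro ⟨f, rfl⟩
    refine ⟨_, by simp, fun B hB => ?_, rfl⟩
    obtain ⟨j, rfl⟩ := List.mem_ofFn.1 hB
    exact ⟨f j, rfl⟩

/-- The `n²`-dimensional matrix algebra is spanned by at most `g ^ k` words. -/
theorem sq_le_pow_of_spansAtLength {g k : ℕ} {A : Fin g → Matrix (Fin n) (Fin n) ℂ}
    (h : SpansAtLength (Set.range A) k) : n ^ 2 ≤ g ^ k := by
  have := finrank_range_le_card (R := ℂ) fun f : Fin k → Fin g =>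
    (List.ofFn fun j => A (f j)).prod
  rw [Set.finrank, ← wordsOfLength_range, h, finrank_top, Module.finrank_matrix] at this
  simpa [sq] using this

theorem spansAtLength_of_det_ne_zero {g k : ℕ} {A : Fin g → Matrix (Fin n) (Fin n) ℂ}
    {u : Fin n × Fin n → List (Fin g)} (hu : ∀ p, (u p).length = k)
    (h : (Matrix.of fun p q : Fin n × Fin n => ((u p).map A).prod q.1 q.2).det ≠ 0) :
    SpansAtLength (Set.range A) k := by
  set N := Matrix.of fun p q : Fin n × Fin n => ((u p).map A).prod q.1 q.2 with hN
  refine eq_top_iff.2 fun M _ => ?_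
  have hM : M = ∑ p, Matrix.vecMul (fun q : Fin n × Fin n => M q.1 q.2) N⁻¹ p •
      ((u p).map A).prod := by
    have key : Matrix.vecMul (Matrix.vecMul (fun q : Fin n × Fin n => M q.1 q.2) N⁻¹) N =
        fun q => M q.1 q.2 := by
      rw [Matrix.vecMul_vecMul, Matrix.nonsing_inv_mul _ (isUnit_iff_ne_zero.2 h),
        Matrix.vecMul_one]
    ext s t
    rw [Matrix.sum_apply]
    exact (congrFun key (s, t)).symm
  rw [hM]
  refine Submodule.sum_mem _ fun p _ => Submodule.smul_mem _ _ (Submodule.subset_span ?_)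
  refine ⟨_, by simp [hu], fun B hB => ?_, rfl⟩
  obtain ⟨i, -, rfl⟩ := List.mem_map.1 hB
  exact ⟨i, rfl⟩

theorem differentiable_prod_apply {g : ℕ} (w : List (Fin g)) (s t : Fin n) :
    Differentiable ℂ fun A : Fin g → Fin n → Fin n → ℂ =>
      (w.map fun i => Matrix.of (A i)).prod s t := by
  induction w generalizing s with
  | nil => simp
  | cons i w ih =>
    simp only [List.map_cons, List.prod_cons, Matrix.mul_apply, Matrix.of_apply]
    exact Differentiable.fun_sum fun j _ => (by fun_prop : Differentiable ℂ
      fun A : Fin g → Fin n → Fin n → ℂ => A i s j).mul (ih j)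

/-- A determinant in the entries of `A` detects that the given words span, so one tuple for which
they do is enough. -/
theorem ae_spansAtLength_of_det_ne_zero {g k : ℕ} {A₀ : Fin g → Matrix (Fin n) (Fin n) ℂ}
    {u : Fin n × Fin n → List (Fin g)} (hu : ∀ p, (u p).length = k)
    (h : (Matrix.of fun p q : Fin n × Fin n => ((u p).map A₀).prod q.1 q.2).det ≠ 0) :
    ∀ᵐ A : Fin g → Matrix (Fin n) (Fin n) ℂ, SpansAtLength (Set.range A) k := by
  have hnull : NullZeroSets (volume : Measure (Fin g → Fin n → Fin n → ℂ)) := by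
    have h0 : NullZeroSets (volume : Measure ℂ) := fun F hF z hz =>
      ae_ne_zero_of_differentiable hF hz
    exact ((h0.pi n).pi n).pi g
  have hd : Differentiable ℂ fun A : Fin g → Fin n → Fin n → ℂ =>
      (Matrix.of fun p q : Fin n × Fin n =>
        ((u p).map fun i => Matrix.of (A i)).prod q.1 q.2).det := by
    simp only [Matrix.det_apply, Matrix.of_apply]
    refine Differentiable.fun_sum fun σ _ => ?_
    have hσ : Differentiable ℂ fun A : Fin g → Fin n → Fin n → ℂ =>
        ∏ p : Fin n × Fin n, ((u (σ p)).map fun i => Matrix.of (A i)).prod p.1 p.2 := by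
      classical
      exact fun A => (HasFDerivAt.finsetProd fun p _ =>
        (differentiable_prod_apply (u (σ p)) p.1 p.2 A).hasFDerivAt).differentiableAt
    exact hσ.const_smul _
  have := hnull _ hd A₀ h
  change ∀ᵐ A ∂(volume : Measure (Fin g → Fin n → Fin n → ℂ)), _
  filter_upwards [this] with A hA
  exact spansAtLength_of_det_ne_zero hu hA

theorem ae_spansAtLength {g : ℕ} (hg : 2 ≤ g) (hn : 1 ≤ n) :
    ∀ᵐ A : Fin g → Matrix (Fin n) (Fin n) ℂ,
      SpansAtLength (Set.range A) (2 * ⌈Real.logb (g : ℝ) (n : ℝ)⌉₊) := by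
  have : NeZero g := ⟨by omega⟩
  rw [Real.natCeil_logb_natCast]
  obtain ⟨step, policy, hreset, hinj⟩ := exists_reset_step (g := g) (Nat.clog g n) n (by
    rcases hn.eq_or_lt with rfl | hn
    · simp
    · exact (Nat.pow_pred_clog_lt_self (by omega) hn).le) (Nat.le_pow_clog (by omega) n)
  obtain ⟨A, u, hu, hdet⟩ := exists_det_words_ne_zero step policy _ hreset hinj
  exact ae_spansAtLength_of_det_ne_zero hu hdet

theorem log_le_of_sq_le_pow {g k : ℕ} (hg : 2 ≤ g) (hn : 1 ≤ n) (h : n ^ 2 ≤ g ^ k) :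
    2 / Real.log g * Real.log n ≤ k := by
  have hg' : 0 < Real.log g := Real.log_pos (by exact_mod_cast hg)
  have h' : ((n : ℝ) ^ 2) ≤ (g : ℝ) ^ k := by exact_mod_cast h
  have := Real.log_le_log (by positivity) h'
  rw [Real.log_pow, Real.log_pow] at this
  rw [div_mul_eq_mul_div, div_le_iff₀ hg']
  exact_mod_cast this

theorem ceil_logb_le {g : ℕ} (hg : 2 ≤ g) (hn : 1 ≤ n) :
    ((2 * ⌈Real.logb (g : ℝ) (n : ℝ)⌉₊ : ℕ) : ℝ) ≤
      (2 / Real.log g + 2 / Real.log 2) * Real.log n := by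
  rcases hn.eq_or_lt with rfl | hn
  · simp
  have hg' : 0 < Real.log g := Real.log_pos (by exact_mod_cast hg)
  have h2 : 0 < Real.log 2 := Real.log_pos one_lt_two
  have hn2 : Real.log 2 ≤ Real.log n := Real.log_le_log two_pos (by exact_mod_cast hn)
  have hc := (Nat.ceil_lt_add_one (a := Real.logb g n)
    (div_nonneg (h2.le.trans hn2) hg'.le)).le
  have h1 : 1 ≤ Real.log n / Real.log 2 := (one_le_div h2).2 hn2
  push_cast
  calc 2 * (⌈Real.logb (g : ℝ) (n : ℝ)⌉₊ : ℝ)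
      ≤ 2 * (Real.log n / Real.log g + Real.log n / Real.log 2) := by
        rw [Real.logb] at hc ⊢
        linarith
    _ = _ := by ring

theorem theorem1 (g : ℕ) (hg : 2 ≤ g) :
    (∀ n : ℕ, 1 ≤ n →
      -- tuples of too large (possibly infinite) Wie-length form a null set
      volume {A : Fin g → Matrix (Fin n) (Fin n) ℂ |
          ((2 * ⌈Real.logb (g : ℝ) (n : ℝ)⌉₊ : ℕ) : ℕ∞) < wieLength (Set.range A)} = 0 ∧
      -- words of length exactly `2 ⌈log_g n⌉` in a generic tuple span
      (∀ᵐ A : Fin g → Matrix (Fin n) (Fin n) ℂ,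
        SpansAtLength (Set.range A) (2 * ⌈Real.logb (g : ℝ) (n : ℝ)⌉₊)) ∧
      -- counting lower bound, for every tuple that is a Wie-generating system
      (∀ (A : Fin g → Matrix (Fin n) (Fin n) ℂ) (k : ℕ),
        wieLength (Set.range A) = (k : ℕ∞) → n ^ 2 ≤ g ^ k)) ∧
    -- the generic Wie-length is of order `Θ(log n)`
    (∃ c C : ℝ, 0 < c ∧ 0 < C ∧ ∀ n : ℕ, 1 ≤ n →
      ∀ᵐ A : Fin g → Matrix (Fin n) (Fin n) ℂ, ∃ k : ℕ, wieLength (Set.range A) = (k : ℕ∞) ∧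
        c * Real.log (n : ℝ) ≤ (k : ℝ) ∧ (k : ℝ) ≤ C * Real.log (n : ℝ)) := by
  refine ⟨fun n hn => ⟨?_, ae_spansAtLength hg hn, fun A k hk =>
      sq_le_pow_of_spansAtLength (spansAtLength_of_wieLength_eq hk)⟩,
    2 / Real.log g, 2 / Real.log g + 2 / Real.log 2, ?_, ?_, fun n hn => ?_⟩
  · refine measure_mono_null ?_ (ae_iff.1 (ae_spansAtLength hg hn))
    exact Set.ofPred_subset_ofPred.2 fun A hA hs => absurd (wieLength_le hs) (not_le.2 hA)
  · have hg' : 0 < Real.log g := Real.log_pos (by exact_mod_cast hg)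
    positivity
  · have hg' : 0 < Real.log g := Real.log_pos (by exact_mod_cast hg)
    have h2 : 0 < Real.log 2 := Real.log_pos one_lt_two
    positivity
  · filter_upwards [ae_spansAtLength hg hn] with A hA
    have hle := wieLength_le hA
    obtain ⟨k, hk⟩ := ENat.ne_top_iff_exists.1 (ne_top_of_le_ne_top (ENat.natCast_ne_top _) hle)
    refine ⟨k, hk.symm, log_le_of_sq_le_pow hg hn
      (sq_le_pow_of_spansAtLength (spansAtLength_of_wieLength_eq hk.symm)), ?_⟩
    rw [← hk, Nat.cast_le] at hle
    exact (Nat.cast_le.2 hle).trans (ceil_logb_le hg hn)
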